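/- **Setting.** A *snap action* over a set $P$ of propositions is $h=\langle pres(h),adds(h),dels(h)\rangle$ with $pres(h),adds(h),dels(h)\subseteq P$. A *durative action* $a$ consists of a start snap action $a_\vdash$, an end snap action $a_\dashv$, a set of invariants $over\_all(a)\subseteq P$, and a lower and an upper duration bound $\langle l_a,\triangleleft_a\rangle$, $\langle\triangleleft'_a,u_a\rangle$ with $l_a,u_a\in\mathbb Q$ and $\triangleleft_a,\triangleleft'_a\in\{<,\le\}$; a duration $d$ satisfies the bounds if $l_a\triangleleft_a d$ and $d\triangleleft'_a u_a$. A *temporal planning problem* $\mathcal P=\langle P,A,I,G\rangle$ has finitely many durative actions $A=\{a_1,\dots,a_N\}$ and $I,G\subseteq P$. Actions are identified by their index, and snap actions of $\mathcal P$ by their action and kind (start/end), so that differently named snap actions count as different. Two snap actions $g,h$ are *mutex* if $pres(g)\cap(adds(h)\cup dels(h))\neq\emptyset$ or $adds(g)\cap dels(h)\neq\emptyset$, or the same with $g,h$ exchanged. Fix $\epsilon\in\mathbb Q$ with $\epsilon\ge 0$. A *plan* $\pi$ is a finite list of triples $\langle\alpha,t,d\rangle$ with $\alpha\in A$ and $t,d\in\mathbb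 Q$. Its induced parallel plan is the set $B$ of all $\langle t,\alpha_\vdash\rangle$ and $\langle t+d,\alpha_\dashv\rangle$ with $\langle\alpha,t,d\rangle\in\pi$. Let $t_0<\dots<t_{k-1}$ be the time points occurring in $B$ (possibly $k=0$). The plan is *valid* if 1. there are states $M_0,\dots,M_k\subseteq P$ with $M_0=I$, $G\subseteq M_k$ such that for every $i<k$: $pres(h)\subseteq M_i$ whenever $\langle t_i,h\rangle\in B$; $M_{i+1}=(M_i\setminus Dels(t_i))\cup Adds(t_i)$, where $Adds(t_i)$, $Dels(t_i)$ are the unions of $adds(h)$, $dels(h)$ over all $\langle t_i,h\rangle\in B$; and $over\_all(\alpha)\subseteq M_i$ for all $\langle\alpha,t,d\rangle\in\pi$ with $t<t_i\le t+d$; 2. for each $\langle\alpha,t,d\rangle\in\pi$, $d\ge0$ and $d$ satisfies the duration bounds of $\alpha$; 3. if $\langle s,g\rangle,\langle t,h\rangle\in B$, $g\ne h$ and $g,h$ are mutex, then $0<|t-s|$ and $\epsilon\le|t-s|$. It has *no self-overlap* if any two distinct $\langle\alpha,t,d\rangle,\langle\beta,t',d'\rangle\in\pi$ with $t\le t'\le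 t+d$ satisfy $\alpha\ne\beta$. **The network.** Integer variables: $v_p$ and $l_p$ for $p\in P$, $aa$, and $ps$. Clocks (values in $\mathbb Q$): one clock $c_h$ for each snap action $h$ of $\mathcal P$. A transition is given as $\langle$condition, guard, updates, resets$\rangle$; conditions and guards are conjunctions. For a snap action $b$ let $\mathit{mutex\_guards}(b)$ consist of $0<c_h$ and $\epsilon\le c_h$ for all snap actions $h\neq b$ of $\mathcal P$ that are mutex with $b$; $\mathit{dur}(a)$ of $l_a\triangleleft_a c_{a_\vdash}$ and $c_{a_\vdash}\triangleleft'_a u_a$; $\mathit{effs}(b)$ of $v_p:=0$ for $p\in dels(b)\setminus adds(b)$ and $v_p:=1$ for $p\in adds(b)$; $\mathit{pre}(b)$ of $v_p=1$ for $p\in pres(b)$; $\mathit{free}(b)$ of $l_p=0$ for $p\in dels(b)\setminus adds(b)$. The main automaton $\mathcal A_M$ has locations $init_M$ (initial, urgent), $plan_M$, $goal_M$ and transitions - $init_M\to plan_M$: $\langle\emptyset,\emptyset,\{ps:=1\}\cup\{v_p:=1\mid p\in I\},\emptyset\rangle$, - $plan_M\to goal_M$: $\langle\{aa=0\}\cup\{v_p=1\mid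 p\in G\},\emptyset,\{ps:=2\},\emptyset\rangle$, - $goal_M\to goal_M$: $\langle\emptyset,\emptyset,\emptyset,\emptyset\rangle$. For each $a\in A$ the automaton $\mathcal A_a$ has locations $inactive$ (initial), $starting$ (urgent), $running$, $ending$ (urgent) and the following transitions, all of which carry the additional condition $ps=1$: - $inactive\to starting$: $\langle \mathit{pre}(a_\vdash)\cup\mathit{free}(a_\vdash),\ \mathit{mutex\_guards}(a_\vdash),\ \mathit{effs}(a_\vdash)\cup\{aa:=aa+1\},\ \{c_{a_\vdash}\}\rangle$, - $starting\to running$: $\langle\{v_p=1\mid p\in over\_all(a)\},\ \emptyset,\ \{l_p:=l_p+1\mid p\in over\_all(a)\},\ \emptyset\rangle$, - $running\to ending$: $\langle\emptyset,\ \mathit{mutex\_guards}(a_\dashv)\cup\mathit{dur}(a),\ \{l_p:=l_p-1\mid p\in over\_all(a)\},\ \{c_{a_\dashv}\}\rangle$, - $ending\to inactive$: $\langle\mathit{pre}(a_\dashv)\cup\mathit{free}(a_\dashv),\ \emptyset,\ \mathit{effs}(a_\dashv)\cup\{aa:=aa-1\},\ \emptyset\rangle$, - $starting\to ending$: $\langle\emptyset,\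 \mathit{mutex\_guards}(a_\dashv)\cup\mathit{dur}(a),\ \emptyset,\ \{c_{a_\dashv}\}\rangle$. The network is $\mathcal A=[\mathcal A_M,\mathcal A_{a_1},\dots,\mathcal A_{a_N}]$. In its initial configuration all automata are in their initial locations and all variables and clocks are $0$. A delay by $\delta\ge0$ adds $\delta$ to all clocks and changes nothing else; it is possible if $\delta=0$ or no automaton is in an urgent location. An internal step takes one transition of one automaton whose source is its current location and whose condition and guard hold; it performs the updates simultaneously and resets the listed clocks to $0$. A (finite) run is a list of configurations in which each one is reached from the previous one by a delay followed by an internal step. $\mathcal A\vDash EF(loc(\mathcal A_M)=goal_M)$ means that some run from the initial configuration contains a configuration in which $\mathcal A_M$ is in $goal_M$. **Theorem 1.** If a plan $\pi$ is valid for $\mathcal P$ and has no self-overlap, then $\mathcal A\vDash EF(loc(\mathcal A_M)=goal_M)$. Consequently, if $\mathcal A\not\vDash EF(loc(\mathcal A_M)=goal_M)$, then $\mathcal P$ has no valid plan without self-overlap. -/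

import Mathlib

namespace TemporalPlanning

universe u

/-! ### Comparison relations -/

/-- The comparison operators `<, ≤, =, ≥, >`. -/
inductive Cmp where
  | lt | le | eq | ge | gt

/-- Meaning of a comparison operator on rational numbers. -/
def Cmp.Holds : Cmp → ℚ → ℚ → Prop
  | .lt, x, y => x < y
  | .le, x, y => x ≤ y
  | .eq, x, y => x = y
  | .ge, x, y => x ≥ y
  | .gt, x, y => x > y

/-- The two relations `<` and `≤` used in duration bounds. -/
inductive BoundRel where
  | lt | le

/-- Meaning of a bound relation on rational numbers. -/
def BoundRel.Holds : BoundRel → ℚ → ℚ → Prop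
  | .lt, x, y => x < y
  | .le, x, y => x ≤ y

/-! ### Temporal planning -/

/-- A snap action over the propositions `P`. -/
structure SnapAction (P : Type u) where
  pres : Set P
  adds : Set P
  dels : Set P

/-- A durative action: a start and an end snap action, invariants, and a lower and an upper bound
on the duration, each of them strict or non-strict. -/
structure DurativeAction (P : Type u) where
  atStart : SnapAction P
  atEnd : SnapAction P
  overAll : Set P
  lower : ℚ
  lowerRel : BoundRel
  upper : ℚ
  upperRel : BoundRel

/-- The duration `d` respects both duration bounds of `a`. -/
def DurativeAction.DurSat {P : Type u} (a : DurativeAction P) (d : ℚ) : Prop :=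
  a.lowerRel.Holds a.lower d ∧ a.upperRel.Holds d a.upper

/-- A temporal planning problem over the set (here: type) `P` of propositions. The finitely many
durative actions are identified by their indices. -/
structure PlanningProblem (P : Type u) where
  numActions : ℕ
  action : Fin numActions → DurativeAction P
  initial : Set P
  goal : Set P

/-- Names of the snap actions of a problem with `n` durative actions. As actions are identified
by their index, two snap actions with different names are different snap actions of the problem,
even if they have the same preconditions and effects. -/
inductive Snap (n : ℕ) where
  | start (a : Fin n)
  | finish (a : Fin n)

/-- The preconditions and effects of a named snap action. -/
def PlanningProblem.snap {P : Type u} (Pb : PlanningProblem P) :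
    Snap Pb.numActions → SnapAction P
  | .start a => (Pb.action a).atStart
  | .finish a => (Pb.action a).atEnd

/-- `a` and `b` overlap, in this order: a precondition of `a` is added or deleted by `b`, or
`a` adds something that `b` deletes. -/
def SnapAction.Overlaps {P : Type u} (a b : SnapAction P) : Prop :=
  (a.pres ∩ b.adds).Nonempty ∨ (a.pres ∩ b.dels).Nonempty ∨ (a.adds ∩ b.dels).Nonempty

/-- Two snap actions are mutually exclusive if they overlap, in one order or the other. -/
def Mutex {P : Type u} (a b : SnapAction P) : Prop :=
  a.Overlaps b ∨ b.Overlaps a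

/-- A plan action: a durative action (its index) with a start time and a duration. -/
structure PlanAction (n : ℕ) where
  act : Fin n
  time : ℚ
  dur : ℚ

/-- A plan is a list of plan actions. -/
abbrev Plan (n : ℕ) := List (PlanAction n)

/-- The induced parallel plan: all scheduled snap actions with their times. -/
def Plan.tss {n : ℕ} (π : Plan n) : Set (ℚ × Snap n) :=
  {x | ∃ e ∈ π, x = (e.time, Snap.start e.act) ∨ x = (e.time + e.dur, Snap.finish e.act)}

/-- The happening time point sequence: the times occurring in the induced parallel plan, without
repetition and in increasing order. -/
noncomputable def Plan.htps {n : ℕ} (π : Plan n) : List ℚ :=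
  (π.map (fun e => e.time) ++ π.map (fun e => e.time + e.dur)).toFinset.sort (· ≤ ·)

theorem Plan.mem_htps {n : ℕ} (π : Plan n) (t : ℚ) :
    t ∈ π.htps ↔ ∃ h, (t, h) ∈ π.tss := by
  simp only [Plan.htps, Finset.mem_sort, List.mem_toFinset, List.mem_append, List.mem_map,
    Plan.tss, Set.mem_ofPred_eq, Prod.mk.injEq]
  constructor
  · rintro (⟨e, he, rfl⟩ | ⟨e, he, rfl⟩)
    · exact ⟨_, e, he, Or.inl ⟨rfl, rfl⟩⟩
    · exact ⟨_, e, he, Or.inr ⟨rfl, rfl⟩⟩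
  · rintro ⟨h, e, he, ⟨rfl, -⟩ | ⟨rfl, -⟩⟩
    · exact Or.inl ⟨e, he, rfl⟩
    · exact Or.inr ⟨e, he, rfl⟩

section Validity

variable {P : Type u} (Pb : PlanningProblem P) (π : Plan Pb.numActions)

/-- All propositions added at time `t`. -/
def addsAt (t : ℚ) : Set P := {p | ∃ h, (t, h) ∈ π.tss ∧ p ∈ (Pb.snap h).adds}

/-- All propositions deleted at time `t`. -/
def delsAt (t : ℚ) : Set P := {p | ∃ h, (t, h) ∈ π.tss ∧ p ∈ (Pb.snap h).dels}

/-- All invariants active at time `t`. -/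
def invsAt (t : ℚ) : Set P :=
  {p | ∃ e ∈ π, p ∈ (Pb.action e.act).overAll ∧ e.time < t ∧ t ≤ e.time + e.dur}

/-- `M` is a valid state sequence for the plan: there is one state per happening time point,
describing the world at that time, and one final state. -/
def ValidStateSequence (M : Fin (π.htps.length + 1) → Set P) : Prop :=
  ∀ i : Fin π.htps.length,
    (∀ h, (π.htps.get i, h) ∈ π.tss → (Pb.snap h).pres ⊆ M i.castSucc) ∧
    M i.succ = (M i.castSucc \ delsAt Pb π (π.htps.get i)) ∪ addsAt Pb π (π.htps.get i) ∧
    invsAt Pb π (π.htps.get i) ⊆ M i.castSucc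

/-- Minimum separation of different, mutually exclusive snap actions: `0`-separation for `ε = 0`
and `ε`-separation for `0 < ε`. -/
def Separated (ε : ℚ) : Prop :=
  ∀ s a t b, (s, a) ∈ π.tss → (t, b) ∈ π.tss → a ≠ b → Mutex (Pb.snap a) (Pb.snap b) →
    0 < |t - s| ∧ ε ≤ |t - s|

/-- Validity of a plan for a planning problem. -/
def ValidPlan (ε : ℚ) : Prop :=
  (∃ M : Fin (π.htps.length + 1) → Set P,
    ValidStateSequence Pb π M ∧ M 0 = Pb.initial ∧ Pb.goal ⊆ M (Fin.last _)) ∧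
  (∀ e ∈ π, (Pb.action e.act).DurSat e.dur) ∧
  (∀ e ∈ π, 0 ≤ e.dur) ∧
  Separated Pb π ε

end Validity

/-- No action overlaps with itself: distinct plan actions whose closed execution intervals
intersect refer to different durative actions. -/
def NoSelfOverlap {n : ℕ} (π : Plan n) : Prop :=
  ∀ e ∈ π, ∀ f ∈ π, e ≠ f → e.time ≤ f.time → f.time ≤ e.time + e.dur → e.act ≠ f.act

/-! ### Networks of timed automata -/

/-- A clock constraint `x ⋈ d`. -/
structure ClockConstraint (X : Type) where
  clock : X
  rel : Cmp
  bound : ℚ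

/-- The clock valuation `c` satisfies a constraint. -/
def ClockConstraint.Sat {X : Type} (c : X → ℚ) (g : ClockConstraint X) : Prop :=
  g.rel.Holds (c g.clock) g.bound

/-- Arithmetic operators. -/
inductive Op where
  | add | sub | mul | div

/-- Meaning of the arithmetic operators. -/
def Op.apply : Op → ℚ → ℚ → ℚ
  | .add, x, y => x + y
  | .sub, x, y => x - y
  | .mul, x, y => x * y
  | .div, x, y => x / y

/-- Arithmetic expressions over the variables `V`. -/
inductive AExp (V : Type u) where
  | var (z : V)
  | const (d : ℚ)
  | op (o : Op) (e f : AExp V)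

/-- Value of an expression under an assignment of integers to the variables. -/
def AExp.eval {V : Type u} (v : V → ℤ) : AExp V → ℚ
  | .var z => (v z : ℚ)
  | .const d => d
  | .op o e f => o.apply (e.eval v) (f.eval v)

/-- Boolean expressions over the variables `V`. -/
inductive BExp (V : Type u) where
  | cmp (r : Cmp) (e f : AExp V)
  | and (b c : BExp V)
  | bot

/-- Truth of a Boolean expression under an assignment of integers to the variables. -/
def BExp.Sat {V : Type u} (v : V → ℤ) : BExp V → Prop
  | .cmp r e f => r.Holds (e.eval v) (f.eval v)
  | .and b c => b.Sat v ∧ c.Sat v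
  | .bot => False

/-- A transition `⟨l, b, g, u, r, l'⟩`. The condition `b` and the guard `g` are conjunctions,
given by the sets of their conjuncts. -/
structure Transition (L X : Type) (V : Type u) where
  src : L
  cond : Set (BExp V)
  guard : Set (ClockConstraint X)
  updates : Set (V × AExp V)
  resets : Set X
  tgt : L

/-- A timed automaton with locations in `L`, clocks `X`, integer variables `V`, and a set of
urgent locations. -/
structure TimedAutomaton (L X : Type) (V : Type u) where
  locs : Set L
  initial : L
  urgent : Set L
  trans : Set (Transition L X V)
  initial_mem : initial ∈ locs
  urgent_subset : urgent ⊆ locs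
  trans_mem : ∀ t ∈ trans, t.src ∈ locs ∧ t.tgt ∈ locs

/-- A network is a list of `n` timed automata that share clocks and variables. -/
abbrev Network (n : ℕ) (L X : Type) (V : Type u) := Fin n → TimedAutomaton L X V

/-- A configuration of a network of `n` automata. -/
structure Config (n : ℕ) (L X : Type) (V : Type u) where
  loc : Fin n → L
  var : V → ℤ
  clock : X → ℚ

section Semantics

variable {n : ℕ} {L X : Type} {V : Type u} (A : Network n L X V)

/-- Delay by `δ ≥ 0`. No time passes while some automaton is in an urgent location; the trivial
delay `δ = 0` is always possible. -/
def Delay (δ : ℚ) (q q' : Config n L X V) : Prop :=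
  0 ≤ δ ∧ ((∃ i, q.loc i ∈ (A i).urgent) → δ = 0) ∧
  q'.loc = q.loc ∧ q'.var = q.var ∧ ∀ x, q'.clock x = q.clock x + δ

/-- The automaton `i` takes the transition `t`. -/
def Fires (i : Fin n) (t : Transition L X V) (q q' : Config n L X V) : Prop :=
  t ∈ (A i).trans ∧
  q.loc i = t.src ∧
  (∀ b ∈ t.cond, b.Sat q.var) ∧
  (∀ g ∈ t.guard, g.Sat q.clock) ∧
  q'.loc i = t.tgt ∧ (∀ j, j ≠ i → q'.loc j = q.loc j) ∧
  (∀ z e, (z, e) ∈ t.updates → (q'.var z : ℚ) = e.eval q.var) ∧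
  (∀ z, (∀ e, (z, e) ∉ t.updates) → q'.var z = q.var z) ∧
  (∀ x ∈ t.resets, q'.clock x = 0) ∧ (∀ x, x ∉ t.resets → q'.clock x = q.clock x)

/-- Internal transition: some automaton takes one of its transitions. -/
def Internal (q q' : Config n L X V) : Prop := ∃ i t, Fires A i t q q'

/-- One step of a run: a delay followed by an internal transition. -/
def RunStep (q q' : Config n L X V) : Prop :=
  ∃ δ r, Delay A δ q r ∧ Internal A r q'

/-- A finite run: consecutive configurations are related by a step. -/
def IsRun (cfgs : List (Config n L X V)) : Prop := cfgs.IsChain (RunStep A)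

/-- The initial configuration: every automaton is in its initial location, and all variables and
clocks are `0`. -/
def initialConfig : Config n L X V where
  loc i := (A i).initial
  var _ := 0
  clock _ := 0

/-- `A ⊨ EF φ` for a property `φ` of configurations: some run from the initial configuration
contains a configuration with the property `φ`. -/
def SatisfiesEF (φ : Config n L X V → Prop) : Prop :=
  ∃ cfgs : List (Config n L X V), cfgs.head? = some (initialConfig A) ∧ IsRun A cfgs ∧
    ∃ q ∈ cfgs, φ q

end Semantics

/-! ### The encoding -/

/-- The integer variables: the truth value and the lock counter of every proposition, the number
of active actions, and the planning state. -/
inductive Var (P : Type u) where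
  | prop (p : P)
  | lock (p : P)
  | aa
  | ps

/-- The locations of the main automaton and of the action automata. -/
inductive Loc where
  | initM | planM | goalM
  | inactive | starting | running | ending

/-- The condition `z = k`. -/
def varEq {P : Type u} (z : Var P) (k : ℚ) : BExp (Var P) := .cmp .eq (.var z) (.const k)

/-- The update `z := k`. -/
def assign {P : Type u} (z : Var P) (k : ℚ) : Var P × AExp (Var P) := (z, .const k)

/-- The update `z := z + 1`. -/
def incr {P : Type u} (z : Var P) : Var P × AExp (Var P) :=
  (z, .op .add (.var z) (.const 1))

/-- The update `z := z - 1`. -/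
def decr {P : Type u} (z : Var P) : Var P × AExp (Var P) :=
  (z, .op .sub (.var z) (.const 1))

/-- The operator `⋈` such that `x ⋈ l` expresses the lower bound `l ◁ x`. -/
def BoundRel.lowerCmp : BoundRel → Cmp
  | .lt => .gt
  | .le => .ge

/-- The operator `⋈` such that `x ⋈ u` expresses the upper bound `x ◁ u`. -/
def BoundRel.upperCmp : BoundRel → Cmp
  | .lt => .lt
  | .le => .le

section Encoding

variable {P : Type u} (Pb : PlanningProblem P) (ε : ℚ)

/-- Transitions of the network. There is one clock per snap action: a start clock and an end
clock for every action. -/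
abbrev Trans := Transition Loc (Snap Pb.numActions) (Var P)

/-- The transition that initialises the encoded state. -/
def e1M : Trans Pb where
  src := .initM
  cond := ∅
  guard := ∅
  updates := {assign .ps 1} ∪ {w | ∃ p ∈ Pb.initial, w = assign (.prop p) 1}
  resets := ∅
  tgt := .planM

/-- The transition that checks the goal and that no action is active. -/
def e2M : Trans Pb where
  src := .planM
  cond := {varEq .aa 0} ∪ {b | ∃ p ∈ Pb.goal, b = varEq (.prop p) 1}
  guard := ∅
  updates := {assign .ps 2}
  resets := ∅
  tgt := .goalM

/-- The loop at the goal location. -/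
def loopM : Trans Pb where
  src := .goalM
  cond := ∅
  guard := ∅
  updates := ∅
  resets := ∅
  tgt := .goalM

/-- The main automaton. -/
def mainAutomaton : TimedAutomaton Loc (Snap Pb.numActions) (Var P) where
  locs := {.initM, .planM, .goalM}
  initial := .initM
  urgent := {.initM}
  trans := {e1M Pb, e2M Pb, loopM Pb}
  initial_mem := by simp
  urgent_subset := by simp
  trans_mem := by
    rintro t (rfl | rfl | rfl) <;> simp [e1M, e2M, loopM]

/-- The snap actions of the problem that interfere with `b`: the other snap actions that are
mutually exclusive with `b`. -/
def intf (b : Snap Pb.numActions) : Set (Snap Pb.numActions) :=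
  {h | h ≠ b ∧ Mutex (Pb.snap b) (Pb.snap h)}

/-- `0 < ch` and `ε ≤ ch` for the clock `ch` of every interfering snap action `h`. -/
def mutexGuards (b : Snap Pb.numActions) : Set (ClockConstraint (Snap Pb.numActions)) :=
  {g | ∃ h ∈ intf Pb b, g = ⟨h, .gt, 0⟩ ∨ g = ⟨h, .ge, ε⟩}

/-- The time since the start of the action respects its duration bounds. -/
def satDurBounds (a : Fin Pb.numActions) : Set (ClockConstraint (Snap Pb.numActions)) :=
  {⟨.start a, (Pb.action a).lowerRel.lowerCmp, (Pb.action a).lower⟩,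
   ⟨.start a, (Pb.action a).upperRel.upperCmp, (Pb.action a).upper⟩}

/-- The effects of a snap action on the propositional variables. -/
def propEffs (b : Snap Pb.numActions) : Set (Var P × AExp (Var P)) :=
  {w | ∃ p ∈ (Pb.snap b).dels \ (Pb.snap b).adds, w = assign (.prop p) 0} ∪
  {w | ∃ p ∈ (Pb.snap b).adds, w = assign (.prop p) 1}

/-- The preconditions of a snap action. -/
def preSat (b : Snap Pb.numActions) : Set (BExp (Var P)) :=
  {c | ∃ p ∈ (Pb.snap b).pres, c = varEq (.prop p) 1}

/-- No effect of the snap action invalidates a locked proposition. -/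
def effSatInvs (b : Snap Pb.numActions) : Set (BExp (Var P)) :=
  {c | ∃ p ∈ (Pb.snap b).dels \ (Pb.snap b).adds, c = varEq (.lock p) 0}

/-- The condition of all transitions of action automata: the planning state is `1`. -/
def planning : Set (BExp (Var P)) := {varEq .ps 1}

/-- From inactive to starting. -/
def seTrans (a : Fin Pb.numActions) : Trans Pb where
  src := .inactive
  cond := planning ∪ preSat Pb (.start a) ∪ effSatInvs Pb (.start a)
  guard := mutexGuards Pb ε (.start a)
  updates := propEffs Pb (.start a) ∪ {incr .aa}
  resets := {.start a}
  tgt := .starting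

/-- From starting to running. -/
def seTrans' (a : Fin Pb.numActions) : Trans Pb where
  src := .starting
  cond := planning ∪ {c | ∃ p ∈ (Pb.action a).overAll, c = varEq (.prop p) 1}
  guard := ∅
  updates := {w | ∃ p ∈ (Pb.action a).overAll, w = incr (.lock p)}
  resets := ∅
  tgt := .running

/-- From running to ending. -/
def eeTrans (a : Fin Pb.numActions) : Trans Pb where
  src := .running
  cond := planning
  guard := mutexGuards Pb ε (.finish a) ∪ satDurBounds Pb a
  updates := {w | ∃ p ∈ (Pb.action a).overAll, w = decr (.lock p)}
  resets := {.finish a}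
  tgt := .ending

/-- From ending to inactive. -/
def eeTrans' (a : Fin Pb.numActions) : Trans Pb where
  src := .ending
  cond := planning ∪ preSat Pb (.finish a) ∪ effSatInvs Pb (.finish a)
  guard := ∅
  updates := propEffs Pb (.finish a) ∪ {decr .aa}
  resets := ∅
  tgt := .inactive

/-- From starting directly to ending, for instantaneous executions. -/
def ieTrans (a : Fin Pb.numActions) : Trans Pb where
  src := .starting
  cond := planning
  guard := mutexGuards Pb ε (.finish a) ∪ satDurBounds Pb a
  updates := ∅
  resets := {.finish a}
  tgt := .ending

/-- The automaton of an action. -/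
def actionAutomaton (a : Fin Pb.numActions) :
    TimedAutomaton Loc (Snap Pb.numActions) (Var P) where
  locs := {.inactive, .starting, .running, .ending}
  initial := .inactive
  urgent := {.starting, .ending}
  trans := {seTrans Pb ε a, seTrans' Pb a, eeTrans Pb ε a, eeTrans' Pb a, ieTrans Pb ε a}
  initial_mem := by simp
  urgent_subset := by
    rintro l (rfl | rfl) <;> simp
  trans_mem := by
    rintro t (rfl | rfl | rfl | rfl | rfl) <;>
      simp [seTrans, seTrans', eeTrans, eeTrans', ieTrans]

/-- The network of a planning problem: the main automaton, at position `0`, followed by the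
automata of all actions. -/
def encode : Network (Pb.numActions + 1) Loc (Snap Pb.numActions) (Var P) :=
  Fin.cons (mainAutomaton Pb) (actionAutomaton Pb ε)

/-- The network satisfies `EF (loc(A_M) = goal_M)`. -/
def GoalReachable : Prop :=
  SatisfiesEF (encode Pb ε) (fun q => q.loc 0 = Loc.goalM)

end Encoding

end TemporalPlanning

namespace TemporalPlanning

universe u

-- The network replays a valid plan happening by happening, waiting between consecutive happenings.
-- Since executions of the same action have disjoint closed intervals, at any time an action has at
-- most one execution, and this execution determines the location of its automaton. While planning,
-- all variables are functions of the locations and the state of the world (`planConfig`).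
--
-- A happening at time `t` is replayed without delay in three phases. Executions that started
-- earlier and end at `t` first release their locks (`reaches_unlock_all`). Then all snap actions of
-- time `t` take effect, action by action (`reaches_effects`). Finally the executions that started
-- at `t` and continue beyond it acquire their locks (`reaches_lock_all`).
--
-- The order inside the second phase is immaterial: different snap actions scheduled at `t` are not
-- mutex, so none deletes what another one adds or requires. Sequential execution thus yields the
-- simultaneous result (`applySnap_applySnaps`) and preserves the outstanding preconditions
-- (`subset_applySnaps`). No lock gets in the way: locks are held only by executions that continue
-- beyond `t`, whose invariants hold in the next state because the next happening of the plan
-- demands them.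
--
-- For the guards, each clock is either large enough for every mutex guard or shows the time since a
-- scheduled occurrence of its snap action (`ClockInv`); in the latter case the separation of the
-- plan is the guard. The start clock of an ongoing execution shows its age, so the duration guards
-- hold at its end.

theorem sum_comp_update {ι β : Type*} [Fintype ι] [DecidableEq ι] (f : ι → β → ℤ) (g : ι → β) (a : ι) (b : β) :
    ∑ i, f i (Function.update g a b i) = ∑ i, f i (g i) - f a (g a) + f a b := by
  rw [← Finset.add_sum_erase _ (fun i => f i (Function.update g a b i)) (Finset.mem_univ a),
    ← Finset.add_sum_erase _ (fun i => f i (g i)) (Finset.mem_univ a)]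
  have : ∑ i ∈ Finset.univ.erase a, f i (Function.update g a b i)
      = ∑ i ∈ Finset.univ.erase a, f i (g i) :=
    Finset.sum_congr rfl fun i hi => by
      rw [Function.update_of_ne (Finset.ne_of_mem_erase hi)]
  simp only [this, Function.update_self]
  ring

-- Runs with delays and internal steps in any order

section Reachability

variable {n : ℕ} {L X : Type} {V : Type u} (A : Network n L X V)

/-- Reachability by delays and internal steps in any order. -/
def Reaches : Config n L X V → Config n L X V → Prop :=
  Relation.ReflTransGen fun q r => (∃ δ, Delay A δ q r) ∨ Internal A q r

variable {A}

theorem Reaches.internal {q r : Config n L X V} (h : Internal A q r) : Reaches A q r :=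
  Relation.ReflTransGen.single (Or.inr h)

theorem Reaches.delay {δ : ℚ} {q r : Config n L X V} (h : Delay A δ q r) : Reaches A q r :=
  Relation.ReflTransGen.single (Or.inl ⟨δ, h⟩)

theorem Reaches.trans {q r s : Config n L X V} (h : Reaches A q r) (h' : Reaches A r s) :
    Reaches A q s :=
  Relation.ReflTransGen.trans h h'

theorem Delay.refl (q : Config n L X V) : Delay A 0 q q :=
  ⟨le_rfl, fun _ => rfl, rfl, rfl, fun _ => (add_zero _).symm⟩

theorem Delay.trans {δ δ' : ℚ} {q r s : Config n L X V} (h : Delay A δ q r)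
    (h' : Delay A δ' r s) : Delay A (δ + δ') q s := by
  obtain ⟨h1, h2, h3, h4, h5⟩ := h
  obtain ⟨k1, k2, k3, k4, k5⟩ := h'
  refine ⟨add_nonneg h1 k1, fun hu => ?_, k3.trans h3, k4.trans h4, fun x => ?_⟩
  · rw [h2 hu, k2 (h3 ▸ hu), add_zero]
  · rw [k5, h5, add_assoc]

/-- Delays preceding an internal step can be merged into run steps. -/
theorem Reaches.exists_runStep {q r s : Config n L X V} (h : Reaches A q r)
    (h' : Internal A r s) : Relation.TransGen (RunStep A) q s := by
  induction h using Relation.ReflTransGen.head_induction_on with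
  | refl => exact .single ⟨0, r, Delay.refl r, h'⟩
  | head hab _ ih =>
    rcases hab with ⟨δ, hd⟩ | hi
    · obtain ⟨b, ⟨δ', c, hc, hcb⟩, hbs⟩ := Relation.TransGen.head'_iff.1 ih
      exact Relation.TransGen.head' ⟨δ + δ', c, hd.trans hc, hcb⟩ hbs
    · exact Relation.TransGen.head ⟨0, _, Delay.refl _, hi⟩ ih

/-- Run steps end with an internal step, so a trailing delay could not be absorbed. The last
internal step is therefore kept separate. -/
theorem SatisfiesEF.of_reaches {φ : Config n L X V → Prop} {r s : Config n L X V}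
    (h : Reaches A (initialConfig A) r) (h' : Internal A r s) (hs : φ s) : SatisfiesEF A φ := by
  obtain ⟨l, hl, hlast⟩ :=
    List.exists_isChain_cons_of_relationReflTransGen (h.exists_runStep h').to_reflTransGen
  exact ⟨_ :: l, rfl, hl, s, hlast ▸ List.getLast_mem _, hs⟩

end Reachability

-- Single transitions of the network while planning

section Steps

variable {P : Type u} (Pb : PlanningProblem P) (ε : ℚ)

open scoped Classical in
/-- The values of the variables while planning, determined by the locations of the action automata
and the current state of the world. -/
noncomputable def planVar (loc : Fin Pb.numActions → Loc) (W : Set P) : Var P → ℤ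
  | .prop p => if p ∈ W then 1 else 0
  | .lock p => ∑ a, if loc a = .running ∧ p ∈ (Pb.action a).overAll then 1 else 0
  | .aa => ∑ a, if loc a = .inactive then 0 else 1
  | .ps => 1

/-- The configuration while planning with given locations of the action automata, given state of
the world and given clock valuation. -/
noncomputable def planConfig (loc : Fin Pb.numActions → Loc) (W : Set P)
    (clk : Snap Pb.numActions → ℚ) :
    Config (Pb.numActions + 1) Loc (Snap Pb.numActions) (Var P) where
  loc := Fin.cons .planM loc
  var := planVar Pb loc W
  clock := clk

/-- The clocks of all snap actions interfering with `b` allow `b` to be executed. -/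
def MutexClear (clk : Snap Pb.numActions → ℚ) (b : Snap Pb.numActions) : Prop :=
  ∀ h, h ≠ b → Mutex (Pb.snap b) (Pb.snap h) → 0 < clk h ∧ ε ≤ clk h

/-- The state after the effects of the snap action `b` in the state `W`. -/
def applySnap (W : Set P) (b : Snap Pb.numActions) : Set P :=
  (W \ (Pb.snap b).dels) ∪ (Pb.snap b).adds

variable {Pb ε} {loc : Fin Pb.numActions → Loc} {W : Set P} {clk : Snap Pb.numActions → ℚ}
  {a : Fin Pb.numActions}

theorem varEq_sat {v : Var P → ℤ} {z : Var P} {k : ℚ} : (varEq z k).Sat v ↔ (v z : ℚ) = k :=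
  Iff.rfl

theorem MutexClear.sat {b : Snap Pb.numActions} (h : MutexClear Pb ε clk b) :
    ∀ g ∈ mutexGuards Pb ε b, g.Sat clk := by
  rintro g ⟨x, ⟨hx, hm⟩, rfl | rfl⟩
  · exact (h x hx hm).1
  · exact (h x hx hm).2

theorem DurativeAction.DurSat.sat (h : (Pb.action a).DurSat (clk (.start a))) :
    ∀ g ∈ satDurBounds Pb a, g.Sat clk := by
  obtain ⟨h1, h2⟩ := h
  rintro g (rfl | rfl)
  · revert h1
    simp only [ClockConstraint.Sat]
    cases (Pb.action a).lowerRel <;> exact id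
  · revert h2
    simp only [ClockConstraint.Sat]
    cases (Pb.action a).upperRel <;> exact id

theorem planVar_prop_eq_one {p : P} (h : p ∈ W) : planVar Pb loc W (.prop p) = 1 := by
  simp [planVar, h]

theorem preSat_sat {b : Snap Pb.numActions} (h : (Pb.snap b).pres ⊆ W) :
    ∀ c ∈ preSat Pb b, c.Sat (planVar Pb loc W) := by
  rintro c ⟨p, hp, rfl⟩
  rw [varEq_sat, planVar_prop_eq_one (h hp), Int.cast_one]

/-- A lock counter is a sum of indicators over the running actions, and under the hypothesis every
summand vanishes. -/
theorem effSatInvs_sat {b : Snap Pb.numActions}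
    (h : ∀ a', loc a' = .running →
      Disjoint (Pb.action a').overAll ((Pb.snap b).dels \ (Pb.snap b).adds)) :
    ∀ c ∈ effSatInvs Pb b, c.Sat (planVar Pb loc W) := by
  rintro c ⟨p, hp, rfl⟩
  rw [varEq_sat]
  norm_cast
  refine Finset.sum_eq_zero fun a' _ => if_neg fun ha => ?_
  exact Set.disjoint_left.1 (h a' ha.1) ha.2 hp

theorem planning_sat : ∀ c ∈ planning, c.Sat (planVar Pb loc W) := by
  rintro c rfl
  rw [varEq_sat]
  simp [planVar]

open scoped Classical in
-- The three cases are the two kinds of updates in `propEffs` and the untouched variables. The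
-- locations on the two sides may differ, since propositional variables do not depend on them.
theorem planVar_applySnap (b : Snap Pb.numActions) (p : P) (l : Fin Pb.numActions → Loc) :
    (p ∈ (Pb.snap b).adds → planVar Pb l (applySnap Pb W b) (.prop p) = 1) ∧
    (p ∈ (Pb.snap b).dels \ (Pb.snap b).adds → planVar Pb l (applySnap Pb W b) (.prop p) = 0) ∧
    (p ∉ (Pb.snap b).dels → p ∉ (Pb.snap b).adds →
      planVar Pb l (applySnap Pb W b) (.prop p) = planVar Pb loc W (.prop p)) := by
  refine ⟨fun h => ?_, fun h => ?_, fun h h' => ?_⟩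
  · simp [planVar, applySnap, h]
  · simp [planVar, applySnap, h.1, h.2]
  · have : p ∈ applySnap Pb W b ↔ p ∈ W := by simp [applySnap, h, h']
    simp only [planVar, this]

open scoped Classical in
theorem planVar_aa_update (l : Loc) (W' : Set P) :
    planVar Pb (Function.update loc a l) W' .aa = planVar Pb loc W .aa -
      (if loc a = .inactive then 0 else 1) + (if l = .inactive then 0 else 1) :=
  sum_comp_update (fun _ l => if l = Loc.inactive then 0 else 1) loc a l

open scoped Classical in
theorem planVar_lock_update (l : Loc) (W' : Set P) (p : P) :
    planVar Pb (Function.update loc a l) W' (.lock p) = planVar Pb loc W (.lock p) -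
      (if loc a = .running ∧ p ∈ (Pb.action a).overAll then 1 else 0) +
      (if l = .running ∧ p ∈ (Pb.action a).overAll then 1 else 0) :=
  sum_comp_update (fun a l => if l = Loc.running ∧ p ∈ (Pb.action a).overAll then 1 else 0) loc a l

open scoped Classical in
/-- An action automaton takes a transition between planning configurations. -/
theorem Reaches.of_trans {t : Trans Pb} {W' : Set P} {clk' : Snap Pb.numActions → ℚ}
    (ht : t ∈ (actionAutomaton Pb ε a).trans) (hsrc : loc a = t.src)
    (hcond : ∀ b ∈ t.cond, b.Sat (planVar Pb loc W))
    (hguard : ∀ g ∈ t.guard, g.Sat clk)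
    (hupd : ∀ z e, (z, e) ∈ t.updates →
      (planVar Pb (Function.update loc a t.tgt) W' z : ℚ) = e.eval (planVar Pb loc W))
    (hkeep : ∀ z, (∀ e, (z, e) ∉ t.updates) →
      planVar Pb (Function.update loc a t.tgt) W' z = planVar Pb loc W z)
    (hreset : ∀ x ∈ t.resets, clk' x = 0) (hclk : ∀ x, x ∉ t.resets → clk' x = clk x) :
    Reaches (encode Pb ε) (planConfig Pb loc W clk)
      (planConfig Pb (Function.update loc a t.tgt) W' clk') := by
  refine .internal ⟨a.succ, t, by simpa [encode] using ht, ?_, hcond, hguard, ?_, ?_, hupd, hkeep,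
    hreset, hclk⟩
  · simpa [planConfig] using hsrc
  · simp [planConfig]
  · intro j hj
    refine Fin.cases (fun _ => rfl) (fun i hi => ?_) j hj
    have : i ≠ a := fun h => hi (h ▸ rfl)
    simp [planConfig, this]

open scoped Classical in
theorem reaches_start (hloc : loc a = .inactive) (hpre : (Pb.snap (.start a)).pres ⊆ W)
    (hfree : ∀ a', loc a' = .running → Disjoint (Pb.action a').overAll
      ((Pb.snap (.start a)).dels \ (Pb.snap (.start a)).adds))
    (hclk : MutexClear Pb ε clk (.start a)) :
    Reaches (encode Pb ε) (planConfig Pb loc W clk)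
      (planConfig Pb (Function.update loc a .starting) (applySnap Pb W (.start a))
        (Function.update clk (.start a) 0)) := by
  refine Reaches.of_trans (t := seTrans Pb ε a) (Or.inl rfl) hloc ?_ hclk.sat ?_ ?_ ?_ ?_
  · rintro b ((hb | hb) | hb)
    exacts [planning_sat b hb, preSat_sat hpre b hb, effSatInvs_sat hfree b hb]
  · rintro z e ((⟨p, hp, h⟩ | ⟨p, hp, h⟩) | h)
    · obtain ⟨rfl, rfl⟩ := Prod.mk.inj h
      simp [AExp.eval, (planVar_applySnap (loc := loc) _ p _).2.1 hp]
    · obtain ⟨rfl, rfl⟩ := Prod.mk.inj h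
      simp [AExp.eval, (planVar_applySnap (loc := loc) _ p _).1 hp]
    · obtain ⟨rfl, rfl⟩ := Prod.mk.inj h
      rw [planVar_aa_update (W := W)]
      simp [AExp.eval, Op.apply, hloc, seTrans]
  · rintro (p | p | _ | _) hz
    · refine (planVar_applySnap _ p _).2.2 (fun h => ?_) (fun h => ?_)
      · by_cases h' : p ∈ (Pb.snap (.start a)).adds
        · exact hz _ (Or.inl (Or.inr ⟨p, h', rfl⟩))
        · exact hz _ (Or.inl (Or.inl ⟨p, ⟨h, h'⟩, rfl⟩))
      · exact hz _ (Or.inl (Or.inr ⟨p, h, rfl⟩))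
    · rw [planVar_lock_update (W := W)]
      simp [hloc, seTrans]
    · exact absurd (Or.inr rfl) (hz _)
    · rfl
  · rintro x rfl
    simp
  · intro x hx
    exact Function.update_of_ne hx _ _

open scoped Classical in
theorem reaches_finish (hloc : loc a = .ending) (hpre : (Pb.snap (.finish a)).pres ⊆ W)
    (hfree : ∀ a', loc a' = .running → Disjoint (Pb.action a').overAll
      ((Pb.snap (.finish a)).dels \ (Pb.snap (.finish a)).adds)) :
    Reaches (encode Pb ε) (planConfig Pb loc W clk)
      (planConfig Pb (Function.update loc a .inactive) (applySnap Pb W (.finish a)) clk) := by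
  refine Reaches.of_trans (t := eeTrans' Pb a) (by simp [actionAutomaton]) hloc ?_
    (fun _ h => h.elim) ?_ ?_ (fun _ h => h.elim) (fun _ _ => rfl)
  · rintro b ((hb | hb) | hb)
    exacts [planning_sat b hb, preSat_sat hpre b hb, effSatInvs_sat hfree b hb]
  · rintro z e ((⟨p, hp, h⟩ | ⟨p, hp, h⟩) | h)
    · obtain ⟨rfl, rfl⟩ := Prod.mk.inj h
      simp [AExp.eval, (planVar_applySnap (loc := loc) _ p _).2.1 hp]
    · obtain ⟨rfl, rfl⟩ := Prod.mk.inj h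
      simp [AExp.eval, (planVar_applySnap (loc := loc) _ p _).1 hp]
    · obtain ⟨rfl, rfl⟩ := Prod.mk.inj h
      rw [planVar_aa_update (W := W)]
      simp [AExp.eval, Op.apply, hloc, eeTrans']
  · rintro (p | p | _ | _) hz
    · refine (planVar_applySnap _ p _).2.2 (fun h => ?_) (fun h => ?_)
      · by_cases h' : p ∈ (Pb.snap (.finish a)).adds
        · exact hz _ (Or.inl (Or.inr ⟨p, h', rfl⟩))
        · exact hz _ (Or.inl (Or.inl ⟨p, ⟨h, h'⟩, rfl⟩))
      · exact hz _ (Or.inl (Or.inr ⟨p, h, rfl⟩))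
    · rw [planVar_lock_update (W := W)]
      simp [hloc, eeTrans']
    · exact absurd (Or.inr rfl) (hz _)
    · rfl

open scoped Classical in
theorem reaches_lock (hloc : loc a = .starting) (hinv : (Pb.action a).overAll ⊆ W) :
    Reaches (encode Pb ε) (planConfig Pb loc W clk)
      (planConfig Pb (Function.update loc a .running) W clk) := by
  refine Reaches.of_trans (t := seTrans' Pb a) (by simp [actionAutomaton]) hloc ?_
    (fun _ h => h.elim) ?_ ?_ (fun _ h => h.elim) (fun _ _ => rfl)
  · rintro b (hb | ⟨p, hp, rfl⟩)
    · exact planning_sat b hb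
    · rw [varEq_sat, planVar_prop_eq_one (hinv hp), Int.cast_one]
  · rintro z e ⟨p, hp, h⟩
    obtain ⟨rfl, rfl⟩ := Prod.mk.inj h
    rw [planVar_lock_update (W := W)]
    simp [AExp.eval, Op.apply, hloc, seTrans', hp]
  · rintro (p | p | _ | _) hz
    · rfl
    · have hp : p ∉ (Pb.action a).overAll := fun hp => hz _ ⟨p, hp, rfl⟩
      rw [planVar_lock_update (W := W)]
      simp [hp]
    · rw [planVar_aa_update (W := W)]
      simp [hloc, seTrans']
    · rfl

open scoped Classical in
theorem reaches_unlock (hloc : loc a = .running) (hclk : MutexClear Pb ε clk (.finish a))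
    (hdur : (Pb.action a).DurSat (clk (.start a))) :
    Reaches (encode Pb ε) (planConfig Pb loc W clk)
      (planConfig Pb (Function.update loc a .ending) W (Function.update clk (.finish a) 0)) := by
  refine Reaches.of_trans (t := eeTrans Pb ε a) (by simp [actionAutomaton]) hloc planning_sat
    ?_ ?_ ?_ ?_ ?_
  · rintro g (hg | hg)
    exacts [hclk.sat g hg, hdur.sat g hg]
  · rintro z e ⟨p, hp, h⟩
    obtain ⟨rfl, rfl⟩ := Prod.mk.inj h
    rw [planVar_lock_update (W := W)]
    simp [AExp.eval, Op.apply, hloc, eeTrans, hp]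
  · rintro (p | p | _ | _) hz
    · rfl
    · have hp : p ∉ (Pb.action a).overAll := fun hp => hz _ ⟨p, hp, rfl⟩
      rw [planVar_lock_update (W := W)]
      simp [hp]
    · rw [planVar_aa_update (W := W)]
      simp [hloc, eeTrans]
    · rfl
  · rintro x rfl
    simp
  · intro x hx
    exact Function.update_of_ne hx _ _

open scoped Classical in
theorem reaches_instant (hloc : loc a = .starting) (hclk : MutexClear Pb ε clk (.finish a))
    (hdur : (Pb.action a).DurSat (clk (.start a))) :
    Reaches (encode Pb ε) (planConfig Pb loc W clk)
      (planConfig Pb (Function.update loc a .ending) W (Function.update clk (.finish a) 0)) := by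
  refine Reaches.of_trans (t := ieTrans Pb ε a) (by simp [actionAutomaton]) hloc planning_sat
    ?_ (fun _ _ h => h.elim) ?_ ?_ ?_
  · rintro g (hg | hg)
    exacts [hclk.sat g hg, hdur.sat g hg]
  · rintro (p | p | _ | _) _
    · rfl
    · rw [planVar_lock_update (W := W)]
      simp [hloc, ieTrans]
    · rw [planVar_aa_update (W := W)]
      simp [hloc, ieTrans]
    · rfl
  · rintro x rfl
    simp
  · intro x hx
    exact Function.update_of_ne hx _ _

/-- The location `planM` is not urgent, so only an action automaton in `starting` or `ending` could
forbid the delay. -/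
theorem reaches_delay {δ : ℚ} (hδ : 0 ≤ δ)
    (hloc : ∀ a, loc a = .inactive ∨ loc a = .running) :
    Reaches (encode Pb ε) (planConfig Pb loc W clk)
      (planConfig Pb loc W fun h => clk h + δ) := by
  refine .delay (δ := δ) ⟨hδ, ?_, rfl, rfl, fun _ => rfl⟩
  rintro ⟨i, hi⟩
  exfalso
  revert hi
  refine Fin.cases ?_ (fun a => ?_) i
  · simp [planConfig, encode, mainAutomaton]
  · rcases hloc a with h | h <;> simp [planConfig, encode, actionAutomaton, h]

theorem reaches_init :
    Reaches (encode Pb ε) (initialConfig (encode Pb ε))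
      (planConfig Pb (fun _ => .inactive) Pb.initial fun _ => 0) := by
  refine .internal ⟨0, e1M Pb, ?_, rfl, fun _ h => h.elim, fun _ h => h.elim, rfl, ?_, ?_, ?_,
    fun _ h => h.elim, fun _ _ => rfl⟩
  · simp [encode, mainAutomaton]
  · intro j hj
    refine Fin.cases (fun h => (h rfl).elim) (fun i _ => ?_) j hj
    simp [planConfig, initialConfig, encode, actionAutomaton]
  · rintro z e (h | ⟨p, hp, h⟩)
    · obtain ⟨rfl, rfl⟩ := Prod.mk.inj h
      simp [planConfig, planVar, AExp.eval]
    · obtain ⟨rfl, rfl⟩ := Prod.mk.inj h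
      simp [planConfig, planVar, AExp.eval, hp]
  · rintro (p | p | _ | _) hz
    · have hp : p ∉ Pb.initial := fun hp => hz _ (Or.inr ⟨p, hp, rfl⟩)
      simp [planConfig, planVar, initialConfig, hp]
    · simp [planConfig, planVar, initialConfig]
    · simp [planConfig, planVar, initialConfig]
    · exact absurd (Or.inl rfl) (hz _)

theorem goalReachable_of_reaches
    (h : Reaches (encode Pb ε) (initialConfig (encode Pb ε))
      (planConfig Pb (fun _ => .inactive) W clk)) (hgoal : Pb.goal ⊆ W) :
    GoalReachable Pb ε := by
  classical
  let s : Config (Pb.numActions + 1) Loc (Snap Pb.numActions) (Var P) :=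
    { loc := Fin.cons .goalM fun _ => .inactive
      var := Function.update (planVar Pb (fun _ => .inactive) W) .ps 2
      clock := clk }
  refine SatisfiesEF.of_reaches (s := s) h ⟨0, e2M Pb, ?_, rfl, ?_, fun _ h => h.elim, rfl, ?_,
    ?_, ?_, fun _ h => h.elim, fun _ _ => rfl⟩ rfl
  · simp [encode, mainAutomaton]
  · rintro b (rfl | ⟨p, hp, rfl⟩)
    · simp [varEq_sat, planConfig, planVar]
    · simp [varEq_sat, planConfig, planVar, hgoal hp]
  · intro j hj
    refine Fin.cases (fun h => (h rfl).elim) (fun i _ => ?_) j hj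
    simp [planConfig, s]
  · rintro z e h
    obtain ⟨rfl, rfl⟩ := Prod.mk.inj h
    simp [s, AExp.eval]
  · intro z hz
    have : z ≠ .ps := by
      rintro rfl
      exact hz _ rfl
    simp [s, this, planConfig]

end Steps

-- Executions without self-overlap and the locations they determine

section Plans

variable {n : ℕ} {π : Plan n} {t : ℚ}

/-- The durative action that a snap action belongs to. -/
def Snap.act : Snap n → Fin n
  | .start a => a
  | .finish a => a

/-- The closed execution interval of `e` contains `t`. -/
def PlanAction.ActiveAt (e : PlanAction n) (t : ℚ) : Prop :=
  e.time ≤ t ∧ t ≤ e.time + e.dur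

/-- Of two executions containing `t`, the one starting later starts by time `t`, hence inside the
interval of the other one. All uses of the absence of self-overlap go through this uniqueness. -/
theorem NoSelfOverlap.eq_of_activeAt (hno : NoSelfOverlap π) {e f : PlanAction n} (he : e ∈ π)
    (hf : f ∈ π) (het : e.ActiveAt t) (hft : f.ActiveAt t) (h : e.act = f.act) : e = f := by
  by_contra hne
  rcases le_total e.time f.time with hle | hle
  · exact hno e he f hf hne hle (hft.1.trans het.2) h
  · exact hno f hf e he (Ne.symm hne) hle (het.1.trans hft.2) h.symm

theorem mem_tss_start {a : Fin n} :
    (t, Snap.start a) ∈ π.tss ↔ ∃ e ∈ π, e.act = a ∧ e.time = t := by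
  simp [Plan.tss, eq_comm, and_comm]

theorem mem_tss_finish {a : Fin n} :
    (t, Snap.finish a) ∈ π.tss ↔ ∃ e ∈ π, e.act = a ∧ e.time + e.dur = t := by
  simp [Plan.tss, eq_comm, and_comm]

theorem exists_activeAt_of_mem_tss (hnn : ∀ e ∈ π, 0 ≤ e.dur) {h : Snap n}
    (hh : (t, h) ∈ π.tss) : ∃ e ∈ π, e.act = h.act ∧ e.ActiveAt t := by
  cases h with
  | start a =>
    obtain ⟨e, he, rfl, rfl⟩ := mem_tss_start.1 hh
    exact ⟨e, he, rfl, le_rfl, le_add_of_nonneg_right (hnn e he)⟩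
  | finish a =>
    obtain ⟨e, he, rfl, rfl⟩ := mem_tss_finish.1 hh
    exact ⟨e, he, rfl, le_add_of_nonneg_right (hnn e he), le_rfl⟩

theorem NoSelfOverlap.mem_tss_start_iff (hno : NoSelfOverlap π) (hnn : ∀ e ∈ π, 0 ≤ e.dur)
    {e : PlanAction n} (he : e ∈ π) (het : e.ActiveAt t) :
    (t, Snap.start e.act) ∈ π.tss ↔ e.time = t := by
  rw [mem_tss_start]
  refine ⟨?_, fun h => ⟨e, he, rfl, h⟩⟩
  rintro ⟨f, hf, hfe, rfl⟩
  rw [hno.eq_of_activeAt he hf het ⟨le_rfl, le_add_of_nonneg_right (hnn f hf)⟩ hfe.symm]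

theorem NoSelfOverlap.mem_tss_finish_iff (hno : NoSelfOverlap π) (hnn : ∀ e ∈ π, 0 ≤ e.dur)
    {e : PlanAction n} (he : e ∈ π) (het : e.ActiveAt t) :
    (t, Snap.finish e.act) ∈ π.tss ↔ e.time + e.dur = t := by
  rw [mem_tss_finish]
  refine ⟨?_, fun h => ⟨e, he, rfl, h⟩⟩
  rintro ⟨f, hf, hfe, rfl⟩
  rw [hno.eq_of_activeAt he hf het ⟨le_add_of_nonneg_right (hnn f hf), le_rfl⟩ hfe.symm]

open scoped Classical in
/-- Every action with an execution at time `t` is in the location `g e`, where `e` is this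
execution; all other actions are inactive. -/
noncomputable def locAt (π : Plan n) (t : ℚ) (g : PlanAction n → Loc) (a : Fin n) : Loc :=
  if h : ∃ e ∈ π, e.act = a ∧ e.ActiveAt t then g h.choose else .inactive

/-- By uniqueness, the execution chosen in `locAt` can only be `e`. -/
theorem NoSelfOverlap.locAt_act (hno : NoSelfOverlap π) {e : PlanAction n} (he : e ∈ π)
    (het : e.ActiveAt t) (g : PlanAction n → Loc) : locAt π t g e.act = g e := by
  have h : ∃ f ∈ π, f.act = e.act ∧ f.ActiveAt t := ⟨e, he, rfl, het⟩
  rw [locAt, dif_pos h]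
  obtain ⟨h1, h2, h3⟩ := h.choose_spec
  rw [hno.eq_of_activeAt h1 he h3 het h2]

theorem locAt_of_not_exists {a : Fin n} (h : ¬ ∃ e ∈ π, e.act = a ∧ e.ActiveAt t)
    (g : PlanAction n → Loc) : locAt π t g a = .inactive :=
  dif_neg h

open scoped Classical in
/-- The locations between two happenings: an action is running if it has an execution whose start,
but not its end, lies in the past. -/
noncomputable def runningLoc (π : Plan n) (past : ℚ → Prop) (a : Fin n) : Loc :=
  if ∃ e ∈ π, e.act = a ∧ past e.time ∧ ¬ past (e.time + e.dur) then .running else .inactive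

theorem runningLoc_cases (past : ℚ → Prop) (a : Fin n) :
    runningLoc π past a = .inactive ∨ runningLoc π past a = .running := by
  unfold runningLoc
  split_ifs <;> simp

open scoped Classical in
-- Only start and end times matter, and these are happening times. This permits switching between a
-- past given by an index and one given by comparison with a time.
theorem runningLoc_congr {past past' : ℚ → Prop}
    (h : ∀ s ∈ π.htps, past s ↔ past' s) : runningLoc π past = runningLoc π past' := by
  funext a
  unfold runningLoc
  have : (∃ e ∈ π, e.act = a ∧ past e.time ∧ ¬ past (e.time + e.dur)) ↔
      ∃ e ∈ π, e.act = a ∧ past' e.time ∧ ¬ past' (e.time + e.dur) := by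
    refine exists_congr fun e => and_congr_right fun he => ?_
    rw [h _ ((π.mem_htps _).2 ⟨_, e, he, Or.inl rfl⟩),
      h _ ((π.mem_htps _).2 ⟨_, e, he, Or.inr rfl⟩)]
  exact if_congr this rfl rfl

open scoped Classical in
-- Links the locations between happenings to those used within the happening at `t`: every running
-- execution contains `t`, so it is the only candidate for its action.
theorem NoSelfOverlap.runningLoc_eq_locAt (hno : NoSelfOverlap π) {past : ℚ → Prop}
    (hpast : ∀ e ∈ π, past e.time → ¬ past (e.time + e.dur) → e.ActiveAt t) :
    runningLoc π past =
      locAt π t fun e => if past e.time ∧ ¬ past (e.time + e.dur) then .running else .inactive := by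
  funext a
  by_cases h : ∃ e ∈ π, e.act = a ∧ e.ActiveAt t
  · obtain ⟨e, he, rfl, het⟩ := h
    rw [hno.locAt_act he het, runningLoc]
    refine if_congr ⟨?_, fun h => ⟨e, he, rfl, h⟩⟩ rfl rfl
    rintro ⟨f, hf, hfe, hp⟩
    rwa [hno.eq_of_activeAt he hf het (hpast f hf hp.1 hp.2) hfe.symm]
  · rw [locAt_of_not_exists h, runningLoc, if_neg]
    rintro ⟨f, hf, hfe, hp⟩
    exact h ⟨f, hf, hfe, hpast f hf hp.1 hp.2⟩

end Plans

-- Replaying all snap actions of one time point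

section Happenings

variable {P : Type u} {Pb : PlanningProblem P} {ε : ℚ} {π : Plan Pb.numActions} {t : ℚ}
  {M W : Set P} {clk : Snap Pb.numActions → ℚ}

/-- Equal times violate `0 < |t - s|`, also when `ε = 0`. -/
theorem Separated.not_mutex (hsep : Separated Pb π ε) {g h : Snap Pb.numActions}
    (hg : (t, g) ∈ π.tss) (hh : (t, h) ∈ π.tss) (hne : g ≠ h) :
    ¬ Mutex (Pb.snap g) (Pb.snap h) := fun hm => by
  have := (hsep t g t h hg hh hne hm).1
  simp at this

variable (Pb π ε t) in
/-- Every clock either permits all interfering snap actions or measures the time since some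
execution of its snap action. -/
def ClockInv (clk : Snap Pb.numActions → ℚ) : Prop :=
  ∀ h, (0 < clk h ∧ ε ≤ clk h) ∨ ∃ s ≤ t, (s, h) ∈ π.tss ∧ clk h = t - s

/-- If the clock shows `t - s` for a scheduled occurrence at `s`, the guard is the separation of
that occurrence from `b` at `t`. -/
theorem ClockInv.mutexClear (hclk : ClockInv Pb ε π t clk) (hsep : Separated Pb π ε)
    {b : Snap Pb.numActions} (hb : (t, b) ∈ π.tss) : MutexClear Pb ε clk b := by
  intro h hne hm
  rcases hclk h with h1 | ⟨s, hs, hsh, heq⟩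
  · exact h1
  · have := hsep s h t b hsh hb hne hm.symm
    rwa [abs_of_nonneg (sub_nonneg.2 hs), ← heq] at this

open scoped Classical in
theorem ClockInv.reset (hclk : ClockInv Pb ε π t clk) {b : Snap Pb.numActions}
    (hb : (t, b) ∈ π.tss) : ClockInv Pb ε π t (Function.update clk b 0) := by
  intro h
  by_cases hh : h = b
  · subst hh
    exact Or.inr ⟨t, le_rfl, hb, by simp⟩
  · rw [Function.update_of_ne hh]
    exact hclk h

theorem ClockInv.delay {T : ℚ} (hclk : ClockInv Pb ε π T clk) (hT : T ≤ t) :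
    ClockInv Pb ε π t fun h => clk h + (t - T) := by
  intro h
  rcases hclk h with ⟨h1, h2⟩ | ⟨s, hs, hsh, heq⟩
  · exact Or.inl ⟨by linarith, by linarith⟩
  · exact Or.inr ⟨s, hs.trans hT, hsh, by dsimp only; rw [heq]; ring⟩

/-- The state after executing the snap actions in `D` simultaneously in the state `M`. -/
def applySnaps (M : Set P) (D : Set (Snap Pb.numActions)) : Set P :=
  (M \ {p | ∃ h ∈ D, p ∈ (Pb.snap h).dels}) ∪ {p | ∃ h ∈ D, p ∈ (Pb.snap h).adds}

/-- The two sides could differ only at a proposition that `b` deletes and does not add, while a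
member of `D` adds it. Such a member would be mutex with `b`. -/
theorem applySnap_applySnaps {D : Set (Snap Pb.numActions)} {b : Snap Pb.numActions}
    (hD : ∀ h ∈ D, h ≠ b → ¬ Mutex (Pb.snap h) (Pb.snap b)) :
    applySnap Pb (applySnaps M D) b = applySnaps M (insert b D) := by
  have key : ∀ p, ∀ h ∈ D, p ∈ (Pb.snap h).adds → p ∈ (Pb.snap b).dels →
      p ∈ (Pb.snap b).adds := by
    intro p h hh ha hd
    by_cases hne : h = b
    · rwa [← hne]
    · exact (hD h hh hne (Or.inl (Or.inr (Or.inr ⟨p, ha, hd⟩)))).elim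
  ext p
  simp only [applySnap, applySnaps, Set.mem_union, Set.mem_sdiff, Set.mem_ofPred_eq,
    Set.mem_insert_iff, exists_eq_or_imp]
  have := key p
  grind

/-- A precondition of `b` could be lost only through a deletion by a member of `D`, which would then
be mutex with `b`. -/
theorem subset_applySnaps {D : Set (Snap Pb.numActions)} {b : Snap Pb.numActions}
    (hD : ∀ h ∈ D, h ≠ b → ¬ Mutex (Pb.snap h) (Pb.snap b)) (hb : b ∉ D)
    (hpre : (Pb.snap b).pres ⊆ M) : (Pb.snap b).pres ⊆ applySnaps M D := by
  intro p hp
  refine Or.inl ⟨hpre hp, ?_⟩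
  rintro ⟨h, hh, hd⟩
  exact hD h hh (fun e => hb (e ▸ hh)) (Or.inr (Or.inr (Or.inl ⟨p, hp, hd⟩)))

open scoped Classical in
/-- Moving all actions, one after the other, from the locations `l` to the locations `l'`. -/
theorem exists_reaches_of_forall_action {l l' : Fin Pb.numActions → Loc}
    (Q : Finset (Fin Pb.numActions) → Set P → (Snap Pb.numActions → ℚ) → Prop)
    (h0 : Q ∅ W clk)
    (step : ∀ X a loc W clk, a ∉ X → loc a = l a → (∀ b, loc b = l b ∨ loc b = l' b) →
      Q X W clk → ∃ W' clk', Q (insert a X) W' clk' ∧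
        Reaches (encode Pb ε) (planConfig Pb loc W clk)
          (planConfig Pb (Function.update loc a (l' a)) W' clk')) :
    ∃ W' clk', Q Finset.univ W' clk' ∧
      Reaches (encode Pb ε) (planConfig Pb l W clk) (planConfig Pb l' W' clk') := by
  -- The actions in `X` have already moved to `l'`, the others are still at `l`.
  have key : ∀ X : Finset (Fin Pb.numActions), ∃ W' clk', Q X W' clk' ∧
      Reaches (encode Pb ε) (planConfig Pb l W clk)
        (planConfig Pb (X.piecewise l' l) W' clk') := by
    intro X
    induction X using Finset.induction_on with
    | empty =>
      refine ⟨W, clk, h0, ?_⟩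
      rw [Finset.piecewise_empty]
      exact Relation.ReflTransGen.refl
    | insert a X ha ih =>
      obtain ⟨W', clk', hQ, hr⟩ := ih
      obtain ⟨W'', clk'', hQ', hr'⟩ := step X a (X.piecewise l' l) W' clk' ha (by simp [ha])
        (fun b => by by_cases hb : b ∈ X <;> simp [hb]) hQ
      refine ⟨W'', clk'', hQ', hr.trans ?_⟩
      rwa [Finset.piecewise_insert]
  simpa using key Finset.univ

open scoped Classical in
/-- All executions that end at time `t` give up their invariants. -/
theorem reaches_unlock_all (hno : NoSelfOverlap π) (hsep : Separated Pb π ε)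
    (hdur : ∀ e ∈ π, (Pb.action e.act).DurSat e.dur) (hclk : ClockInv Pb ε π t clk)
    (hstart : ∀ e ∈ π, e.time < t → t ≤ e.time + e.dur → clk (.start e.act) = t - e.time) :
    ∃ clk', ClockInv Pb ε π t clk' ∧
      (∀ e ∈ π, e.time < t → t ≤ e.time + e.dur → clk' (.start e.act) = t - e.time) ∧
      Reaches (encode Pb ε)
        (planConfig Pb (locAt π t fun e => if e.time < t then .running else .inactive) M clk)
        (planConfig Pb (locAt π t fun e =>
          if e.time < t then (if t < e.time + e.dur then .running else .ending) else .inactive)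
          M clk') := by
  refine Exists.elim (exists_reaches_of_forall_action (ε := ε) (W := M)
    (clk := clk) (l := locAt π t fun e => if e.time < t then .running else .inactive)
    (l' := locAt π t fun e =>
      if e.time < t then (if t < e.time + e.dur then .running else .ending) else .inactive)
    (fun _ W c => W = M ∧ ClockInv Pb ε π t c ∧
      ∀ e ∈ π, e.time < t → t ≤ e.time + e.dur → c (.start e.act) = t - e.time)
    ⟨rfl, hclk, hstart⟩ ?step) ?main
  case main =>
    rintro _ ⟨clk', ⟨rfl, h1, h2⟩, h3⟩
    exact ⟨clk', h1, h2, h3⟩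
  rintro X a loc W c _ hloc _ ⟨rfl, hc, hs⟩
  have stay : ∀ l', l' = loc a → ∃ W' c', (W' = W ∧ ClockInv Pb ε π t c' ∧
      ∀ e ∈ π, e.time < t → t ≤ e.time + e.dur → c' (.start e.act) = t - e.time) ∧
      Reaches (encode Pb ε) (planConfig Pb loc W c)
        (planConfig Pb (Function.update loc a l') W' c') := by
    rintro _ rfl
    refine ⟨W, c, ⟨rfl, hc, hs⟩, ?_⟩
    rw [Function.update_eq_self]
    exact Relation.ReflTransGen.refl
  by_cases h : ∃ e ∈ π, e.act = a ∧ e.ActiveAt t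
  · obtain ⟨e, he, rfl, het⟩ := h
    rw [hno.locAt_act he het] at hloc ⊢
    by_cases h1 : e.time < t
    · by_cases h2 : t < e.time + e.dur
      · exact stay _ (by simp [hloc, h1, h2])
      · have hend : e.time + e.dur = t := le_antisymm (not_lt.1 h2) het.2
        have hb : (t, Snap.finish e.act) ∈ π.tss := mem_tss_finish.2 ⟨e, he, rfl, hend⟩
        refine ⟨W, Function.update c (.finish e.act) 0, ⟨rfl, hc.reset hb, fun f hf h h' => ?_⟩,
          ?_⟩
        · rw [Function.update_of_ne (by simp)]
          exact hs f hf h h'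
        · simp only [h1, h2, if_true, if_false] at hloc ⊢
          refine reaches_unlock hloc (hc.mutexClear hsep hb) ?_
          -- The start clock shows the age of the execution, which at its end is its duration.
          rw [hs e he h1 het.2, ← hend, add_sub_cancel_left]
          exact hdur e he
    · exact stay _ (by simp [hloc, h1])
  · rw [locAt_of_not_exists h] at hloc ⊢
    exact stay _ hloc.symm

open scoped Classical in
/-- All executions that start at time `t` and do not end immediately lock their invariants. -/
theorem reaches_lock_all (hno : NoSelfOverlap π)
    (hinv : ∀ e ∈ π, e.time ≤ t → t < e.time + e.dur → (Pb.action e.act).overAll ⊆ M) :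
    Reaches (encode Pb ε)
      (planConfig Pb (locAt π t fun e =>
        if t < e.time + e.dur then (if e.time < t then .running else .starting) else .inactive)
        M clk)
      (planConfig Pb (locAt π t fun e => if t < e.time + e.dur then .running else .inactive)
        M clk) := by
  refine Exists.elim (exists_reaches_of_forall_action (ε := ε) (W := M)
    (clk := clk)
    (l := locAt π t fun e =>
      if t < e.time + e.dur then (if e.time < t then .running else .starting) else .inactive)
    (l' := locAt π t fun e => if t < e.time + e.dur then .running else .inactive)
    (fun _ W c => W = M ∧ c = clk) ⟨rfl, rfl⟩ ?step) ?main
  case main =>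
    rintro _ ⟨_, ⟨rfl, rfl⟩, h3⟩
    exact h3
  rintro X a loc W c _ hloc _ ⟨rfl, rfl⟩
  refine ⟨W, c, ⟨rfl, rfl⟩, ?_⟩
  have stay : ∀ l', l' = loc a → Reaches (encode Pb ε) (planConfig Pb loc W c)
      (planConfig Pb (Function.update loc a l') W c) := by
    rintro _ rfl
    rw [Function.update_eq_self]
    exact Relation.ReflTransGen.refl
  by_cases h : ∃ e ∈ π, e.act = a ∧ e.ActiveAt t
  · obtain ⟨e, he, rfl, het⟩ := h
    rw [hno.locAt_act he het] at hloc ⊢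
    by_cases h1 : t < e.time + e.dur
    · by_cases h2 : e.time < t
      · exact stay _ (by simp [hloc, h1, h2])
      · simp only [h1, h2, if_true, if_false] at hloc ⊢
        exact reaches_lock hloc (hinv e he het.1 h1)
    · exact stay _ (by simp [hloc, h1])
  · rw [locAt_of_not_exists h] at hloc ⊢
    exact stay _ hloc.symm

/-- The scheduled snap actions at time `t` of the actions in `X`. -/
def snapsAt (π : Plan Pb.numActions) (t : ℚ) (X : Finset (Fin Pb.numActions)) :
    Set (Snap Pb.numActions) :=
  {h | (t, h) ∈ π.tss ∧ h.act ∈ X}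

open scoped Classical in
/-- All snap actions scheduled at time `t` take effect. -/
theorem reaches_effects (hno : NoSelfOverlap π) (hsep : Separated Pb π ε)
    (hdur : ∀ e ∈ π, (Pb.action e.act).DurSat e.dur) (hnn : ∀ e ∈ π, 0 ≤ e.dur)
    (hpre : ∀ h, (t, h) ∈ π.tss → (Pb.snap h).pres ⊆ M)
    (hinv : ∀ e ∈ π, e.time ≤ t → t < e.time + e.dur →
      (Pb.action e.act).overAll ⊆ applySnaps M {h | (t, h) ∈ π.tss})
    (hclk : ClockInv Pb ε π t clk)
    (hstart : ∀ e ∈ π, e.time < t → t ≤ e.time + e.dur → clk (.start e.act) = t - e.time) :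
    ∃ clk', ClockInv Pb ε π t clk' ∧
      (∀ e ∈ π, e.ActiveAt t → clk' (.start e.act) = t - e.time) ∧
      Reaches (encode Pb ε)
        (planConfig Pb (locAt π t fun e =>
          if e.time < t then (if t < e.time + e.dur then .running else .ending) else .inactive)
          M clk)
        (planConfig Pb (locAt π t fun e =>
          if t < e.time + e.dur then (if e.time < t then .running else .starting) else .inactive)
          (applySnaps M {h | (t, h) ∈ π.tss}) clk') := by
  refine Exists.elim (exists_reaches_of_forall_action (ε := ε) (W := M)
    (clk := clk)
    (l := locAt π t fun e =>
      if e.time < t then (if t < e.time + e.dur then .running else .ending) else .inactive)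
    (l' := locAt π t fun e =>
      if t < e.time + e.dur then (if e.time < t then .running else .starting) else .inactive)
    (fun X W c => W = applySnaps M (snapsAt π t X) ∧ ClockInv Pb ε π t c ∧
      ∀ e ∈ π, e.ActiveAt t → (e.time < t ∨ e.act ∈ X) → c (.start e.act) = t - e.time)
    ⟨by simp [applySnaps, snapsAt], hclk, fun e he het h => hstart e he (by simpa using h) het.2⟩ ?step) ?main
  case main =>
    rintro _ ⟨clk', ⟨rfl, h1, h2⟩, h3⟩
    refine ⟨clk', h1, fun e he het => h2 e he het (Or.inr (Finset.mem_univ _)), ?_⟩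
    simpa [snapsAt] using h3
  rintro X a loc W c haX hloc hloc' ⟨rfl, hc, hs⟩
  -- An action that is running at any moment of this phase has an execution that continues beyond
  -- `t`, because neither `l` nor `l'` is `running` otherwise.
  have hfree : ∀ b, (t, b) ∈ π.tss → ∀ a', loc a' = .running →
      Disjoint (Pb.action a').overAll ((Pb.snap b).dels \ (Pb.snap b).adds) := by
    intro b hb a' ha'
    obtain ⟨e, he, rfl, het1, het2⟩ : ∃ e ∈ π, e.act = a' ∧ e.time ≤ t ∧ t < e.time + e.dur := by
      by_cases h : ∃ e ∈ π, e.act = a' ∧ e.ActiveAt t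
      · obtain ⟨e, he, rfl, het⟩ := h
        refine ⟨e, he, rfl, het.1, ?_⟩
        by_contra hlt
        have := hloc' e.act
        rw [hno.locAt_act he het, hno.locAt_act he het, ha'] at this
        simp only [hlt, if_false] at this
        split_ifs at this <;> simp at this
      · have := hloc' a'
        rw [locAt_of_not_exists h, locAt_of_not_exists h, ha'] at this
        simp at this
    refine Set.disjoint_left.2 fun p hp hpb => ?_
    -- The invariant `p` holds after the happening. Either nothing deletes it at `t`, or some `h`
    -- adds it; if `b` deletes it, non-mutexness forces `h = b`, and then `p` is not a proper
    -- deletion.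
    rcases hinv e he het1 het2 hp with ⟨-, hnd⟩ | ⟨h, hh, hadd⟩
    · exact hnd ⟨b, hb, hpb.1⟩
    · refine hsep.not_mutex hh hb ?_ (Or.inl (Or.inr (Or.inr ⟨p, hadd, hpb.1⟩)))
      rintro rfl
      exact hpb.2 hadd
  have hnm : ∀ D ⊆ {h | (t, h) ∈ π.tss}, ∀ b, (t, b) ∈ π.tss →
      ∀ h ∈ D, h ≠ b → ¬ Mutex (Pb.snap h) (Pb.snap b) :=
    fun D hD b hb h hh hne => hsep.not_mutex (hD hh) hb hne
  have hX : snapsAt π t X ⊆ {h | (t, h) ∈ π.tss} := fun h hh => hh.1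
  by_cases h : ∃ e ∈ π, e.act = a ∧ e.ActiveAt t
  · obtain ⟨e, he, rfl, het⟩ := h
    rw [hno.locAt_act he het] at hloc ⊢
    have hsX : Snap.start e.act ∉ snapsAt π t X := fun h => haX h.2
    have hfX : Snap.finish e.act ∉ snapsAt π t X := fun h => haX h.2
    have hst := hno.mem_tss_start_iff hnn he het
    have hfi := hno.mem_tss_finish_iff hnn he het
    have hins : ∀ h, h ∈ snapsAt π t (insert e.act X) ↔ h ∈ snapsAt π t X ∨
        (h = .start e.act ∧ e.time = t) ∨ (h = .finish e.act ∧ e.time + e.dur = t) := by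
      intro h
      rw [← hst, ← hfi]
      cases h <;> simp [snapsAt, Snap.act] <;> grind
    have hs_old : ∀ c' : Snap Pb.numActions → ℚ, (∀ a' ≠ e.act, c' (.start a') = c (.start a')) →
        c' (.start e.act) = t - e.time → ∀ f ∈ π, f.ActiveAt t →
        (f.time < t ∨ f.act ∈ insert e.act X) → c' (.start f.act) = t - f.time := by
      intro c' hc1 hc2 f hf hft hor
      by_cases hfe : f.act = e.act
      · rw [hno.eq_of_activeAt hf he hft het hfe, hc2]
      · rw [hc1 _ hfe]
        exact hs f hf hft (hor.imp_right fun h => (Finset.mem_insert.1 h).resolve_left hfe)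
    -- Four cases: the execution started before `t` or starts at `t`, and it ends after `t` or at
    -- `t`.
    rcases het.1.lt_or_eq with h1 | h1
    · have hse := hs e he het (Or.inl h1)
      rcases het.2.lt_or_eq with h2 | h2
      · refine ⟨_, c, ⟨rfl, hc, hs_old c (fun _ _ => rfl) hse⟩, ?_⟩
        have : snapsAt π t (insert e.act X) = snapsAt π t X := by
          ext h
          rw [hins]
          simp [h1.ne, h2.ne']
        rw [this, Function.update_eq_self_iff.2 (by simp [hloc, h1, h2])]
        exact Relation.ReflTransGen.refl
      · refine ⟨_, c, ⟨rfl, hc, hs_old c (fun _ _ => rfl) hse⟩, ?_⟩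
        have hb := hfi.2 h2.symm
        have : snapsAt π t (insert e.act X) = insert (.finish e.act) (snapsAt π t X) := by
          ext h
          rw [hins]
          simp [h1.ne, h2.symm, or_comm]
        rw [this, ← applySnap_applySnaps (hnm _ hX _ hb)]
        have h2' : ¬ t < e.time + e.dur := h2.not_lt
        simp only [h1, h2', if_true, if_false] at hloc ⊢
        exact reaches_finish hloc (subset_applySnaps (hnm _ hX _ hb) hfX (hpre _ hb))
          (hfree _ hb)
    · have hb := hst.2 h1
      have h1' : ¬ e.time < t := h1.not_lt
      simp only [h1', if_false] at hloc ⊢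
      have r1 := reaches_start hloc (subset_applySnaps (hnm _ hX _ hb) hsX (hpre _ hb))
        (hfree _ hb) (hc.mutexClear hsep hb)
      rw [applySnap_applySnaps (hnm _ hX _ hb)] at r1
      have hc1 := hc.reset hb
      rcases het.2.lt_or_eq with h2 | h2
      · refine ⟨_, Function.update c (.start e.act) 0, ⟨rfl, hc1, hs_old _ (fun a' ha' => ?_) ?_⟩,
          ?_⟩
        · exact Function.update_of_ne (by simpa using ha') _ _
        · simp [h1]
        · have : snapsAt π t (insert e.act X) = insert (.start e.act) (snapsAt π t X) := by
            ext h
            rw [hins, Set.mem_insert_iff]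
            have := h2.ne'
            tauto
          rw [this]
          simpa only [h2, if_true] using r1
      -- An instantaneous execution passes through `starting` and `ending` back to `inactive` and
      -- never locks its invariants.
      · have hb' := hfi.2 h2.symm
        have hX' : insert (.start e.act) (snapsAt π t X) ⊆ {h | (t, h) ∈ π.tss} :=
          Set.insert_subset hb hX
        have r2 := reaches_instant (ε := ε) (W := applySnaps M (insert (.start e.act)
          (snapsAt π t X))) (clk := Function.update c (.start e.act) 0)
          (loc := Function.update loc e.act .starting) (a := e.act) (Function.update_self ..)
          (hc1.mutexClear hsep hb') (by
            -- The start clock has just been reset, so it shows the duration `0`.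
            have hd : e.dur = 0 := by linarith
            simpa [hd] using hdur e he)
        rw [Function.update_idem] at r2
        have r3 := reaches_finish (ε := ε) (W := applySnaps M (insert (.start e.act)
          (snapsAt π t X))) (clk := Function.update (Function.update c (.start e.act) 0)
            (.finish e.act) 0)
          (loc := Function.update loc e.act .ending) (a := e.act) (Function.update_self ..)
          (subset_applySnaps (hnm _ hX' _ hb') (by simpa using hfX) (hpre _ hb'))
          (fun a' ha' => hfree _ hb' a' (by
            by_cases h : a' = e.act
            · subst h
              simp at ha'
            · rwa [Function.update_of_ne h] at ha'))
        rw [Function.update_idem, applySnap_applySnaps (hnm _ hX' _ hb')] at r3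
        refine ⟨_, Function.update (Function.update c (.start e.act) 0) (.finish e.act) 0,
          ⟨rfl, hc1.reset hb', hs_old _ (fun a' ha' => ?_) ?_⟩, ?_⟩
        · rw [Function.update_of_ne (by simp), Function.update_of_ne (by simpa using ha')]
        · simp [h1]
        · have : snapsAt π t (insert e.act X) =
              insert (.finish e.act) (insert (.start e.act) (snapsAt π t X)) := by
            ext h
            rw [hins, Set.mem_insert_iff, Set.mem_insert_iff]
            have := h2.symm
            tauto
          rw [this]
          simpa only [h2.not_lt, if_false] using (r1.trans r2).trans r3
  -- An action without an execution containing `t` has no snap action scheduled at `t`, so nothing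
  -- changes.
  · have hne : ∀ f ∈ π, f.ActiveAt t → f.act ≠ a := fun f hf hft hfa => h ⟨f, hf, hfa, hft⟩
    refine ⟨_, c, ⟨rfl, hc, fun f hf hft hor => hs f hf hft
      (hor.imp_right fun h => (Finset.mem_insert.1 h).resolve_left (hne f hf hft))⟩, ?_⟩
    have : snapsAt π t (insert a X) = snapsAt π t X := by
      ext h
      simp only [snapsAt, Set.mem_ofPred_eq, Finset.mem_insert]
      refine and_congr_right fun hh => or_iff_right ?_
      obtain ⟨f, hf, hfh, hft⟩ := exists_activeAt_of_mem_tss hnn hh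
      exact hfh ▸ hne f hf hft
    rw [locAt_of_not_exists h] at hloc
    rw [this, locAt_of_not_exists h, ← hloc, Function.update_eq_self]
    exact Relation.ReflTransGen.refl

/-- The network simulates a happening of the plan. -/
theorem reaches_happening (hno : NoSelfOverlap π) (hsep : Separated Pb π ε)
    (hdur : ∀ e ∈ π, (Pb.action e.act).DurSat e.dur) (hnn : ∀ e ∈ π, 0 ≤ e.dur)
    (hpre : ∀ h, (t, h) ∈ π.tss → (Pb.snap h).pres ⊆ M)
    (hinv : ∀ e ∈ π, e.time ≤ t → t < e.time + e.dur →
      (Pb.action e.act).overAll ⊆ (M \ delsAt Pb π t) ∪ addsAt Pb π t)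
    (hclk : ClockInv Pb ε π t clk)
    (hstart : ∀ e ∈ π, e.time < t → t ≤ e.time + e.dur → clk (.start e.act) = t - e.time) :
    ∃ clk', ClockInv Pb ε π t clk' ∧
      (∀ e ∈ π, e.ActiveAt t → clk' (.start e.act) = t - e.time) ∧
      Reaches (encode Pb ε) (planConfig Pb (runningLoc π (· < t)) M clk)
        (planConfig Pb (runningLoc π (· ≤ t)) ((M \ delsAt Pb π t) ∪ addsAt Pb π t) clk') := by
  classical
  obtain ⟨clk₁, hc₁, hs₁, r₁⟩ := reaches_unlock_all (M := M) hno hsep hdur hclk hstart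
  obtain ⟨clk₂, hc₂, hs₂, r₂⟩ := reaches_effects (M := M) hno hsep hdur hnn hpre hinv hc₁ hs₁
  have r₃ := reaches_lock_all (ε := ε) (clk := clk₂) hno hinv
  refine ⟨clk₂, hc₂, hs₂, ?_⟩
  convert (r₁.trans r₂).trans r₃ using 2
  · rw [hno.runningLoc_eq_locAt (past := (· < t)) fun e _ h1 h2 => ⟨h1.le, not_lt.1 h2⟩]
    funext a
    by_cases h : ∃ e ∈ π, e.act = a ∧ e.ActiveAt t
    · obtain ⟨e, he, rfl, het⟩ := h
      simp [hno.locAt_act he het, het.2]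
    · simp [locAt_of_not_exists h]
  · rw [hno.runningLoc_eq_locAt (past := (· ≤ t)) fun e _ h1 h2 => ⟨h1, (not_le.1 h2).le⟩]
    funext a
    by_cases h : ∃ e ∈ π, e.act = a ∧ e.ActiveAt t
    · obtain ⟨e, he, rfl, het⟩ := h
      simp [hno.locAt_act he het, het.1]
    · simp [locAt_of_not_exists h]

end Happenings

-- Induction over the happenings of a valid plan

section Main

variable {P : Type u} {Pb : PlanningProblem P} {ε : ℚ} {π : Plan Pb.numActions}

theorem Plan.htps_strictMono {n : ℕ} (π : Plan n) : StrictMono π.htps.get :=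
  (Finset.sortedLT_sort _).strictMono_get

theorem GoalReachable.of_validPlan (hvalid : ValidPlan Pb π ε) (hno : NoSelfOverlap π) :
    GoalReachable Pb ε := by
  obtain ⟨⟨M, hM, hM0, hgoal⟩, hdur, hnn, hsep⟩ := hvalid
  have hmono := π.htps_strictMono
  have hidx : ∀ s ∈ π.htps, ∃ j, π.htps.get j = s := fun s hs => List.mem_iff_get.1 hs
  -- The past is given by an index rather than by a time because there is one more state than there
  -- are happenings: the last index has no time of its own.
  let past : Fin (π.htps.length + 1) → ℚ → Prop := fun i s =>
    ∃ j : Fin π.htps.length, j.castSucc < i ∧ π.htps.get j = s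
  have hpast_castSucc : ∀ i : Fin π.htps.length, ∀ s ∈ π.htps,
      past i.castSucc s ↔ s < π.htps.get i := by
    intro i s hs
    constructor
    · rintro ⟨j, hj, rfl⟩
      exact hmono hj
    · intro h
      obtain ⟨j, rfl⟩ := hidx s hs
      exact ⟨j, hmono.lt_iff_lt.1 h, rfl⟩
  have hpast_succ : ∀ i : Fin π.htps.length, ∀ s ∈ π.htps,
      past i.succ s ↔ s ≤ π.htps.get i := by
    intro i s hs
    constructor
    · rintro ⟨j, hj, rfl⟩
      exact hmono.monotone (Fin.castSucc_lt_succ_iff.1 hj)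
    · intro h
      obtain ⟨j, rfl⟩ := hidx s hs
      exact ⟨j, Fin.castSucc_lt_succ_iff.2 (hmono.le_iff_le.1 h), rfl⟩
  have htime : ∀ e ∈ π, e.time ∈ π.htps := fun e he =>
    (π.mem_htps _).2 ⟨_, e, he, Or.inl rfl⟩
  have hend : ∀ e ∈ π, e.time + e.dur ∈ π.htps := fun e he =>
    (π.mem_htps _).2 ⟨_, e, he, Or.inr rfl⟩
  -- `T` is the plan time reached so far; it only has to precede the remaining happenings.
  have key : ∀ i, ∃ T clk, (∀ j : Fin π.htps.length, i ≤ j.castSucc → T ≤ π.htps.get j) ∧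
      ClockInv Pb ε π T clk ∧
      (∀ e ∈ π, past i e.time → ¬ past i (e.time + e.dur) →
        clk (.start e.act) = T - e.time) ∧
      Reaches (encode Pb ε) (initialConfig (encode Pb ε))
        (planConfig Pb (runningLoc π (past i)) (M i) clk) := by
    intro i
    induction i using Fin.induction with
    | zero =>
      obtain ⟨T, hT⟩ := π.htps.toFinset.bddBelow
      have hp : ∀ s, ¬ past 0 s := fun s ⟨j, hj, _⟩ => Fin.not_lt_zero _ hj
      have hloc : runningLoc π (past 0) = fun _ => .inactive := by
        funext a
        exact if_neg fun ⟨e, _, _, h, _⟩ => hp _ h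
      -- An initial delay of `|ε| + 1` lifts all clocks above `0` and `ε`, so that snap actions
      -- never executed block nothing. Plan time starts at any lower bound `T` of the happenings.
      refine ⟨T, fun _ => 0 + (|ε| + 1), fun j _ => hT (by simp), fun h => Or.inl ?_,
        fun e _ h => (hp _ h).elim, ?_⟩
      · have := abs_nonneg ε
        have := le_abs_self ε
        constructor <;> linarith
      · rw [hloc, hM0]
        exact reaches_init.trans (reaches_delay (by positivity) fun _ => Or.inl rfl)
    | succ i ih =>
      obtain ⟨T, clk, hT, hclk, hs, hr⟩ := ih
      obtain ⟨hpre, hsucc, -⟩ := hM i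
      have hTi := hT i le_rfl
      have hinv : ∀ e ∈ π, e.time ≤ π.htps.get i → π.htps.get i < e.time + e.dur →
          (Pb.action e.act).overAll ⊆ M i.succ := by
        intro e he h1 h2 p hp
        -- The execution ends at a later happening `j`, so happening `i + 1` exists and lies within
        -- the execution. Its invariant condition speaks about the state `M i.succ`.
        obtain ⟨j, hj⟩ := hidx _ (hend e he)
        have hij : i < j := hmono.lt_iff_lt.1 (hj ▸ h2)
        let i' : Fin π.htps.length := ⟨i + 1, lt_of_le_of_lt hij j.2⟩
        have hi' : i < i' := Nat.lt_succ_self _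
        have hi'j : i' ≤ j := hij
        exact (hM i').2.2 ⟨e, he, hp, h1.trans_lt (hmono hi'), hj ▸ hmono.monotone hi'j⟩
      rw [hsucc] at hinv
      obtain ⟨clk', hclk', hs', hr'⟩ := reaches_happening (clk := fun h => clk h +
        (π.htps.get i - T)) hno hsep hdur hnn hpre hinv (hclk.delay hTi) fun e he h1 h2 => by
          rw [hs e he ((hpast_castSucc i _ (htime e he)).2 h1)
            fun h => h2.not_gt ((hpast_castSucc i _ (hend e he)).1 h)]
          ring
      refine ⟨π.htps.get i, clk', fun j hj => hmono.monotone ?_, hclk', fun e he h1 h2 =>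
        hs' e he ⟨(hpast_succ i _ (htime e he)).1 h1, ?_⟩, ?_⟩
      · exact (Fin.succ_le_castSucc_iff.1 hj).le
      · exact (not_le.1 fun h => h2 ((hpast_succ i _ (hend e he)).2 h)).le
      · rw [hsucc, runningLoc_congr (hpast_succ i)]
        refine (hr.trans (reaches_delay (sub_nonneg.2 hTi) (runningLoc_cases _))).trans ?_
        rwa [runningLoc_congr (hpast_castSucc i)]
  -- After the last happening every end lies in the past, so all actions are inactive and the goal
  -- transition is enabled.
  obtain ⟨T, clk, -, -, -, hr⟩ := key (Fin.last _)
  have hloc : runningLoc π (past (Fin.last _)) = fun _ => .inactive := by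
    funext a
    refine if_neg fun ⟨e, he, _, _, h⟩ => h ?_
    obtain ⟨j, hj⟩ := hidx _ (hend e he)
    exact ⟨j, Fin.castSucc_lt_last j, hj⟩
  rw [hloc] at hr
  exact goalReachable_of_reaches hr hgoal

end Main

end TemporalPlanning

theorem theorem1 {P : Type*} (Pb : TemporalPlanning.PlanningProblem P) (ε : ℚ) (hε : 0 ≤ ε) :
    (∀ π : TemporalPlanning.Plan Pb.numActions,
      TemporalPlanning.ValidPlan Pb π ε → TemporalPlanning.NoSelfOverlap π →
        TemporalPlanning.GoalReachable Pb ε) ∧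
    (¬ TemporalPlanning.GoalReachable Pb ε →
      ¬ ∃ π : TemporalPlanning.Plan Pb.numActions,
        TemporalPlanning.ValidPlan Pb π ε ∧ TemporalPlanning.NoSelfOverlap π) := by
  have h : ∀ π : TemporalPlanning.Plan Pb.numActions,
      TemporalPlanning.ValidPlan Pb π ε → TemporalPlanning.NoSelfOverlap π →
        TemporalPlanning.GoalReachable Pb ε :=
    fun _ hvalid hno => TemporalPlanning.GoalReachable.of_validPlan hvalid hno
  exact ⟨h, fun hn ⟨π, hvalid, hno⟩ => hn (h π hvalid hno)⟩
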